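/- A \emph{limit group} is a finitely generated group $\Gamma$ such that for every finite subset $S\subset\Gamma$ there is a homomorphism from $\Gamma$ to a free group whose restriction to $S$ is injective. An action of a group on a tree is \emph{$1$-acylindrical} if every geodesic segment of length greater than $1$ has trivial pointwise stabilizer. Let $\Gamma$ be a limit group which splits as an amalgamated free product $\Gamma=A*_CB$ of subgroups $A,B\le\Gamma$ over a (possibly trivial) cyclic subgroup $C$, and suppose that the splitting is $1$-acylindrical, i.e. that the action of $\Gamma$ on the Bass--Serre tree of the splitting is $1$-acylindrical. Let $\gamma\in\Gamma\smallsetminus A$. Then the subgroup of $\Gamma$ generated by $A$ and $\gamma$ is the free product of its subgroups $A$ and $\langle\gamma\rangle$; that is, the canonical homomorphism $A*\langle\gamma\rangle\to\Gamma$ induced by the inclusions is injective with image $\langle A,\gamma\rangle$. -/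

import Mathlib

universe u

/-- A limit group: a finitely generated group such that every finite subset is mapped injectively
by some homomorphism to a free group. (As the group is finitely generated, the image of such a
homomorphism involves only finitely many letters, so bases in `Type` suffice.) -/
def IsLimitGroup (Γ : Type u) [Group Γ] : Prop :=
  Group.FG Γ ∧ ∀ S : Finset Γ, ∃ (X : Type) (φ : Γ →* FreeGroup X), Set.InjOn φ (S : Set Γ)

/-- The canonical homomorphism to `Γ` from the amalgamated product of a family of subgroups of `Γ`
over a common subgroup `C`, induced by the inclusions. -/
def amalgamMap {Γ : Type u} [Group Γ] {ι : Type*} (H : ι → Subgroup Γ) (C : Subgroup Γ)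
    (h : ∀ i, C ≤ H i) : Monoid.PushoutI (fun i => Subgroup.inclusion (h i)) →* Γ :=
  Monoid.PushoutI.lift (fun i => (H i).subtype) C.subtype (fun _ => rfl)

/-- `Γ = A *_C B`: the subgroup `C` is contained in both `A` and `B`, and the canonical
homomorphism from the amalgamated product of `A` and `B` over `C` to `Γ` is an isomorphism. -/
def IsAmalgamatedProduct {Γ : Type u} [Group Γ] (A B C : Subgroup Γ) : Prop :=
  ∃ h : ∀ i, C ≤ (![A, B] : Fin 2 → Subgroup Γ) i, Function.Bijective (amalgamMap ![A, B] C h)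

/-- The Bass–Serre tree of `Γ = A *_C B`. The vertices are the cosets `gA` and `gB`, and each
`g : Γ` gives an edge between `gA` and `gB`. Two elements `g`, `g'` give the same edge iff
`g⁻¹ * g' ∈ A ⊓ B`; since `A ⊓ B = C` in an amalgamated product, the edges are the cosets `gC`. -/
def bassSerreTree {Γ : Type u} [Group Γ] (A B : Subgroup Γ) :
    SimpleGraph ((Γ ⧸ A) ⊕ (Γ ⧸ B)) where
  Adj x y := ∃ g : Γ, (x = Sum.inl (g : Γ ⧸ A) ∧ y = Sum.inr (g : Γ ⧸ B)) ∨
    (x = Sum.inr (g : Γ ⧸ B) ∧ y = Sum.inl (g : Γ ⧸ A))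
  symm := ⟨fun _ _ ⟨g, h⟩ => ⟨g, h.elim (fun h => Or.inr ⟨h.2, h.1⟩) (fun h => Or.inl ⟨h.2, h.1⟩)⟩⟩
  loopless := ⟨by
    rintro x ⟨g, ⟨h1, h2⟩ | ⟨h1, h2⟩⟩ <;> exact absurd (h1.symm.trans h2) (by simp)⟩

/-- The action of `Γ` on the vertices of the graph `T` is `k`-acylindrical: every geodesic segment
of length greater than `k` has trivial (pointwise) stabilizer. -/
def IsAcylindrical (Γ : Type*) [Group Γ] {V : Type*} [MulAction Γ V] (T : SimpleGraph V)
    (k : ℕ) : Prop :=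
  ∀ (x y : V) (p : T.Walk x y), p.length = T.dist x y → k < p.length →
    ∀ g : Γ, (∀ z ∈ p.support, g • z = z) → g = 1

/-- The subgroup `L` of `Γ` is the (internal) free product of the subgroups `H` and `K`: the
canonical homomorphism `H ∗ K → Γ` is injective with image `L`. -/
def IsInternalFreeProduct {Γ : Type u} [Group Γ] (H K L : Subgroup Γ) : Prop :=
  Function.Injective (Monoid.Coprod.lift H.subtype K.subtype) ∧
    (Monoid.Coprod.lift H.subtype K.subtype).range = L


/-!
By acylindricity, `C` is malnormal in `A` and in `B`. Up to factors in `A` on both sides, `γ ∉ A`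
is an alternating product that starts and ends in `B \ C`, and such a product is never in `A`. It is
therefore enough that every alternating product of nontrivial powers of `γ` and elements of `C` is
again a product of that kind: powers of `γ` separated by letters in `A \ C` do not interact.

If `γ = p * m * q` with `p, q ∈ B` and no cancellation occurs in `q * c * p` for `c ∈ C`, this holds
because malnormality also excludes cancellation in `p⁻¹ * c * p` and `q * c * q⁻¹`. Otherwise `γ`
may be replaced by a conjugate `p * m' * p⁻¹`, whose powers are `p * m' ^ n * p⁻¹`. There remains
`γ ∈ B`: it does not commute with a generator of `C` unless `C` is trivial, and noncommuting
elements of a limit group generate a free group of rank two.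
-/

section FreeGroups

theorem exists_perm_eq_mul_left {G : Type*} [Group G] (P : Finset G) (g : G) :
    ∃ σ : Equiv.Perm P, ∀ x : P, g * x ∈ P → (σ x : G) = g * x := by
  classical
  let e : {x : P // g * x ∈ P} ≃ {x : P // g⁻¹ * x ∈ P} :=
    { toFun x := ⟨⟨g * x, x.2⟩, by simp⟩
      invFun x := ⟨⟨g⁻¹ * x, x.2⟩, by simp⟩
      left_inv x := by simp
      right_inv x := by simp }
  exact ⟨e.extendSubtype, fun x hx => by rw [e.extendSubtype_apply_of_mem x hx]; rfl⟩

/-- A nontrivial reduced word moves the empty suffix when the generators act on its finite set of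
suffixes by permutations extending, as far as possible, left multiplication. -/
instance instResiduallyFiniteFreeGroup {α : Type*} : Group.ResiduallyFinite (FreeGroup α) := by
  classical
  refine Group.residuallyFinite_of_forall_exists_finite_monoidHom fun w hw => ?_
  obtain ⟨L, rfl⟩ : ∃ L, FreeGroup.mk L = w := ⟨w.toWord, FreeGroup.mk_toWord⟩
  let P : Finset (FreeGroup α) := (L.tails.map FreeGroup.mk).toFinset
  have mk_mem {M : List (α × Bool)} (hM : M <:+ L) : FreeGroup.mk M ∈ P :=
    List.mem_toFinset.2 (List.mem_map_of_mem ((List.mem_tails _ _).2 hM))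
  choose σ hσ using fun a : α => exists_perm_eq_mul_left P (FreeGroup.of a)
  have hletter (a : α) (b : Bool) (x y : P) (h : (y : FreeGroup α) = FreeGroup.mk [(a, b)] * x) :
      (cond b (σ a) (σ a)⁻¹) x = y := by
    cases b with
    | true => exact Subtype.ext ((hσ a x (h ▸ y.2)).trans h.symm)
    | false =>
      have hx : FreeGroup.of a * y = x := by
        have hinv : FreeGroup.mk [(a, false)] = (FreeGroup.of a)⁻¹ := rfl
        rw [h, hinv, mul_inv_cancel_left]
      refine Equiv.Perm.inv_eq_iff_eq.2 (Subtype.ext ?_)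
      rw [hσ a y (hx ▸ x.2), hx]
  have hsuffix : ∀ M (hM : M <:+ L),
      FreeGroup.lift σ (FreeGroup.mk M) ⟨1, mk_mem List.nil_suffix⟩ =
        ⟨FreeGroup.mk M, mk_mem hM⟩ := by
    intro M
    induction M with
    | nil => exact fun _ => rfl
    | cons s M ih =>
      intro hM
      have ih := ih ((List.suffix_cons s M).trans hM)
      rw [FreeGroup.lift_mk] at ih ⊢
      rw [List.map_cons, List.prod_cons, Equiv.Perm.mul_apply, ih]
      exact hletter _ _ _ _ (by rw [FreeGroup.mul_mk]; rfl)
  refine ⟨Equiv.Perm P, inferInstance, inferInstance, FreeGroup.lift σ, fun h => hw ?_⟩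
  have := hsuffix L List.suffix_rfl
  rw [h] at this
  exact (congrArg Subtype.val this).symm

theorem finite_monoidHom_of_fg (G Q : Type*) [Group G] [Group.FG G] [Group Q] [Finite Q] :
    Finite (G →* Q) := by
  obtain ⟨S, hS⟩ := Group.fg_def.1 ‹Group.FG G›
  exact Finite.of_injective (fun (φ : G →* Q) (s : S) => φ s) fun φ ψ h =>
    MonoidHom.eq_of_eqOn_dense hS fun s hs => congrFun h ⟨s, hs⟩

/-- Precomposition with `f` permutes the finitely many homomorphisms to a given finite group, so
every such homomorphism kills the kernel of `f`. -/
theorem injective_of_surjective_of_residuallyFinite {G : Type*} [Group G] [Group.FG G]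
    [Group.ResiduallyFinite G] {f : G →* G} (hf : Function.Surjective f) :
    Function.Injective f := by
  refine (injective_iff_map_eq_one f).2 fun g hg => ?_
  by_contra hg1
  obtain ⟨N, hN⟩ := Group.exists_finiteIndexNormalSubgroup_notMem g hg1
  have := finite_monoidHom_of_fg G (G ⧸ N.toSubgroup)
  have hinj : Function.Injective fun φ : G →* G ⧸ N.toSubgroup => φ.comp f :=
    fun φ ψ h => (MonoidHom.cancel_right hf).1 h
  obtain ⟨φ, hφ⟩ := Finite.surjective_of_injective hinj (QuotientGroup.mk' N.toSubgroup)
  refine hN ((QuotientGroup.eq_one_iff g).1 ?_)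
  rw [← QuotientGroup.mk'_apply, ← hφ, MonoidHom.comp_apply, hg, map_one]

theorem commute_freeGroup_of_subsingleton {α : Type*} [Subsingleton α] (x y : FreeGroup α) :
    Commute x y := by
  have hcomm : ∀ a ∈ Set.range (FreeGroup.of (α := α)), ∀ b ∈ Set.range (FreeGroup.of (α := α)),
      a * b = b * a := by
    rintro _ ⟨s, rfl⟩ _ ⟨t, rfl⟩
    rw [Subsingleton.elim s t]
  have hmem (z : FreeGroup α) : z ∈ Subgroup.closure (Set.range FreeGroup.of) := by
    simp only [FreeGroup.closure_range_of, Subgroup.mem_top]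
  have := Subgroup.isMulCommutative_closure hcomm
  exact setLike_mul_comm (hmem x) (hmem y)

/-- A nonabelian free group `H` with two generators maps onto a free group of rank two, so
`F₂ → H → F₂` is onto, hence injective as `F₂` is Hopfian. -/
theorem freeGroupLift_injective_of_not_commute {G : Type*} [Group G] [IsFreeGroup G] {x y : G}
    (hxy : ¬ Commute x y) : Function.Injective (FreeGroup.lift ![x, y]) := by
  classical
  let H := (FreeGroup.lift ![x, y]).range
  let π : FreeGroup (Fin 2) →* H := (FreeGroup.lift ![x, y]).rangeRestrict
  have hπ (i : Fin 2) : (π (FreeGroup.of i) : G) = ![x, y] i := FreeGroup.lift_apply_of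
  let e : H ≃* FreeGroup (IsFreeGroup.Generators H) := IsFreeGroup.toFreeGroup H
  have hS : Nontrivial (IsFreeGroup.Generators H) := by
    refine not_subsingleton_iff_nontrivial.1 fun _ => hxy ?_
    have hcomm : Commute (π (FreeGroup.of 0)) (π (FreeGroup.of 1)) := by
      simpa using (commute_freeGroup_of_subsingleton (e (π (FreeGroup.of 0)))
        (e (π (FreeGroup.of 1)))).map e.symm
    simpa [hπ] using hcomm.map H.subtype
  obtain ⟨s, t, hst⟩ := hS
  let r : IsFreeGroup.Generators H → Fin 2 := fun u => if u = s then 0 else 1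
  have hr : Function.Surjective r := by
    rw [Function.Surjective, Fin.forall_fin_two]
    exact ⟨⟨s, if_pos rfl⟩, ⟨t, if_neg hst.symm⟩⟩
  have hsurj : Function.Surjective (((FreeGroup.map r).comp e.toMonoidHom).comp π) :=
    ((FreeGroup.map_surjective hr).comp e.surjective).comp (MonoidHom.rangeRestrict_surjective _)
  exact fun a b hab => injective_of_surjective_of_residuallyFinite hsurj
    (congrArg (fun z => FreeGroup.map r (e z)) (Subtype.ext hab))

theorem IsLimitGroup.isMulTorsionFree {Γ : Type*} [Group Γ] (hΓ : IsLimitGroup Γ) :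
    IsMulTorsionFree Γ where
  pow_left_injective n hn x y hxy := by
    classical
    obtain ⟨X, φ, hφ⟩ := hΓ.2 {x, y}
    refine hφ (by simp) (by simp) (pow_left_injective hn ?_)
    simpa using congrArg φ hxy

theorem IsLimitGroup.freeGroupLift_injective {Γ : Type*} [Group Γ] (hΓ : IsLimitGroup Γ) {x y : Γ}
    (hxy : ¬ Commute x y) : Function.Injective (FreeGroup.lift ![x, y]) := by
  classical
  obtain ⟨X, φ, hφ⟩ := hΓ.2 {x * y, y * x}
  have hφxy : ¬ Commute (φ x) (φ y) := fun h =>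
    hxy (hφ (by simp) (by simp) (by simpa using h.eq))
  have hcomp : FreeGroup.lift ![φ x, φ y] = φ.comp (FreeGroup.lift ![x, y]) := by
    ext i; fin_cases i <;> simp
  have := freeGroupLift_injective_of_not_commute hφxy
  rw [hcomp] at this
  exact Function.Injective.of_comp this

end FreeGroups

section Alternating

variable {Γ : Type*} [Group Γ] {A B C : Subgroup Γ}

/-- Products `x₁ x₂ ⋯ xₙ` of odd length whose factors lie alternately in `A \ C` and `B \ C`,
the first and the last one in `A \ C`. Words are built from the middle outwards, so that the
definition is symmetric under inversion; `OddAlternating.cons_induction` builds them from the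
right. -/
inductive OddAlternating (C : Subgroup Γ) : Subgroup Γ → Subgroup Γ → Γ → Prop
  | single {A B : Subgroup Γ} {x : Γ} : x ∈ A → x ∉ C → OddAlternating C A B x
  | wrap {A B : Subgroup Γ} {x g y : Γ} : x ∈ A → x ∉ C → OddAlternating C B A g →
      y ∈ A → y ∉ C → OddAlternating C A B (x * g * y)

/-- `C` is a malnormal subgroup of `A`: the conjugates of `C` by elements of `A \ C` meet `C`
trivially. -/
structure IsMalnormalIn (C A : Subgroup Γ) : Prop where
  le : C ≤ A
  eq_one_of_conj_mem : ∀ {x c : Γ}, x ∈ A → x ∉ C → c ∈ C → x * c * x⁻¹ ∈ C → c = 1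

theorem IsMalnormalIn.pow_notMem [IsMulTorsionFree Γ] (hA : IsMalnormalIn C A) {x : Γ}
    (hx : x ∈ A) (hxC : x ∉ C) {n : ℕ} (hn : n ≠ 0) : x ^ n ∉ C := by
  intro hxn
  have hconj : x * x ^ n * x⁻¹ = x ^ n := by rw [← pow_succ', pow_succ, mul_inv_cancel_right]
  have hpow : x ^ n = 1 := hA.eq_one_of_conj_mem hx hxC hxn (hconj.symm ▸ hxn)
  exact hxC ((pow_eq_one_iff_left hn).1 hpow ▸ one_mem C)

theorem IsMalnormalIn.inv_mul_mul_notMem (hA : IsMalnormalIn C A) {l c : Γ} (hl : l ∈ A)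
    (hlC : l ∉ C) (hc : c ∈ C) (hc1 : c ≠ 1) : l⁻¹ * c * l ∉ C := fun h =>
  hc1 (hA.eq_one_of_conj_mem (inv_mem hl) (mt inv_mem_iff.1 hlC) hc (by rwa [inv_inv]))

namespace OddAlternating

theorem inv {g : Γ} (hg : OddAlternating C A B g) : OddAlternating C A B g⁻¹ := by
  induction hg with
  | single hx hxC => exact single (inv_mem hx) (mt inv_mem_iff.1 hxC)
  | wrap hx hxC _ hy hyC ih =>
    rw [mul_inv_rev, mul_inv_rev, ← mul_assoc]
    exact wrap (inv_mem hy) (mt inv_mem_iff.1 hyC) ih (inv_mem hx) (mt inv_mem_iff.1 hxC)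

theorem cons {x y g : Γ} (hx : x ∈ A) (hxC : x ∉ C) (hy : y ∈ B) (hyC : y ∉ C)
    (hg : OddAlternating C A B g) : OddAlternating C A B (x * y * g) := by
  induction hg generalizing x y with
  | single hz hzC => exact wrap hx hxC (single hy hyC) hz hzC
  | @wrap A B x₁ g y₁ hx₁ hx₁C _ hy₁ hy₁C ih =>
    have hassoc : x * y * (x₁ * g * y₁) = x * (y * x₁ * g) * y₁ := by group
    exact hassoc ▸ wrap hx hxC (ih hy hyC hx₁ hx₁C) hy₁ hy₁C

@[elab_as_elim]
theorem cons_induction {motive : ∀ g, OddAlternating C A B g → Prop}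
    (single : ∀ x (hx : x ∈ A) (hxC : x ∉ C), motive x (.single hx hxC))
    (cons : ∀ x y g (hx : x ∈ A) (hxC : x ∉ C) (hy : y ∈ B) (hyC : y ∉ C)
      (hg : OddAlternating C A B g), motive g hg → motive (x * y * g) (hg.cons hx hxC hy hyC))
    {g : Γ} (hg : OddAlternating C A B g) : motive g hg := by
  induction hg with
  | single hx hxC => exact single _ hx hxC
  | @wrap A B x g y hx hxC hg hy hyC ih =>
    have motive_congr {g g' : Γ} (e : g = g') {h : OddAlternating C A B g} (hm : motive g h) :
      ∃ h', motive g' h' := e ▸ ⟨h, hm⟩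
    refine (ih (motive := fun g _ => ∀ x ∈ A, x ∉ C → ∃ h, motive (x * g * y) h) ?_ ?_
      x hx hxC).elim fun _ h => h
    · exact fun b hb hbC x hx hxC => ⟨_, cons _ _ _ hx hxC hb hbC _ (single y hy hyC)⟩
    · intro b a g hb hbC ha haC _ ih x hx hxC
      obtain ⟨_, h⟩ := ih a ha haC
      exact motive_congr (by group) (cons _ _ _ hx hxC hb hbC _ h)

theorem append {g x h : Γ} (hg : OddAlternating C A B g) (hx : x ∈ B) (hxC : x ∉ C)
    (hh : OddAlternating C A B h) : OddAlternating C A B (g * x * h) := by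
  induction hg using cons_induction with
  | single y hy hyC => exact cons hy hyC hx hxC hh
  | cons y z g hy hyC hz hzC _ ih =>
    have hassoc : y * z * g * x * h = y * z * (g * x * h) := by group
    exact hassoc ▸ cons hy hyC hz hzC ih

theorem mul_right {g c : Γ} (hCA : C ≤ A) (hg : OddAlternating C A B g) (hc : c ∈ C) :
    OddAlternating C A B (g * c) := by
  cases hg with
  | single hx hxC =>
    exact single (mul_mem hx (hCA hc)) (mt (Subgroup.mul_mem_cancel_right C hc).1 hxC)
  | wrap hx hxC hg hy hyC =>
    rw [mul_assoc]
    exact wrap hx hxC hg (mul_mem hy (hCA hc)) (mt (Subgroup.mul_mem_cancel_right C hc).1 hyC)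

theorem mem_of_le {H : Subgroup Γ} (hA : A ≤ H) (hB : B ≤ H) {g : Γ}
    (hg : OddAlternating C A B g) : g ∈ H := by
  induction hg with
  | single hx _ => exact hA hx
  | wrap hx _ _ hy _ ih => exact mul_mem (mul_mem (hA hx) (ih hB hA)) (hA hy)

theorem map {G : Type*} [Group G] {A' B' C' : Subgroup G} {g : Γ} (f : Γ →* G)
    (hA : ∀ x ∈ A, x ∉ C → f x ∈ A' ∧ f x ∉ C') (hB : ∀ x ∈ B, x ∉ C → f x ∈ B' ∧ f x ∉ C')
    (hg : OddAlternating C A B g) : OddAlternating C' A' B' (f g) := by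
  induction hg using cons_induction with
  | single x hx hxC => exact single (hA x hx hxC).1 (hA x hx hxC).2
  | cons x y g hx hxC hy hyC _ ih =>
    rw [map_mul, map_mul]
    exact cons (hA x hx hxC).1 (hA x hx hxC).2 (hB y hy hyC).1 (hB y hy hyC).2 ih

theorem exists_pow_eq {x m y : Γ} (hx : x ∈ A) (hy : y ∈ A) (hyx : y * x ∉ C)
    (hm : OddAlternating C B A m) {n : ℕ} (hn : n ≠ 0) :
    ∃ z, OddAlternating C B A z ∧ (x * m * y) ^ n = x * z * y := by
  induction n, Nat.one_le_iff_ne_zero.2 hn using Nat.le_induction with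
  | base => exact ⟨m, hm, pow_one _⟩
  | succ n hn₁ ih =>
    obtain ⟨z, hz, hpow⟩ := ih (Nat.one_le_iff_ne_zero.1 hn₁)
    exact ⟨z * (y * x) * m, hz.append (mul_mem hy hx) hyx hm, by rw [pow_succ, hpow]; group⟩

/-- If `x * m * y * c` is not cyclically reduced, that is, `y * c * x ∈ C`, then it is the conjugate
by `x` of `m * (y * c * x)`: a shorter word times an element of `C`, whence the factor `c`. -/
theorem mul_pow [IsMulTorsionFree Γ] (hA : IsMalnormalIn C A) (hB : IsMalnormalIn C B)
    {g c : Γ} (hg : OddAlternating C A B g) (hc : c ∈ C) {n : ℕ} (hn : n ≠ 0) :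
    OddAlternating C A B ((g * c) ^ n) := by
  induction hg generalizing c with
  | single hx hxC =>
    have hxc := mul_mem hx (hA.le hc)
    have hxcC := mt (Subgroup.mul_mem_cancel_right C hc).1 hxC
    exact single (pow_mem hxc n) (hA.pow_notMem hxc hxcC hn)
  | @wrap A B x m y hx hxC hm hy hyC ih =>
    by_cases hd : y * c * x ∈ C
    · have hconj : x * m * y * c = x * (m * (y * c * x)) * x⁻¹ := by group
      rw [hconj, conj_pow]
      exact wrap hx hxC (ih hB hA hd) (inv_mem hx) (mt inv_mem_iff.1 hxC)
    · have hyc := mul_mem hy (hA.le hc)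
      have hycC := mt (Subgroup.mul_mem_cancel_right C hc).1 hyC
      obtain ⟨z, hz, hpow⟩ := exists_pow_eq hx hyc hd hm hn
      rw [mul_assoc _ y c, hpow]
      exact wrap hx hxC hz hyc hycC

theorem pow [IsMulTorsionFree Γ] (hA : IsMalnormalIn C A) (hB : IsMalnormalIn C B)
    {g : Γ} (hg : OddAlternating C A B g) {n : ℕ} (hn : n ≠ 0) :
    OddAlternating C A B (g ^ n) :=
  mul_one g ▸ mul_pow hA hB hg (one_mem C) hn

end OddAlternating

end Alternating

section NormalForm

variable {Γ : Type*} [Group Γ] {A B C : Subgroup Γ}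

/-- An element lies in `A`, or it is an alternating product that starts and ends in `B \ C`,
up to factors in `A` on both sides. -/
def HasNormalForm (C A B : Subgroup Γ) (g : Γ) : Prop :=
  g ∈ A ∨ ∃ o, OddAlternating C B A o ∧ g ∈ DoubleCoset.doubleCoset o (A : Set Γ) A

namespace HasNormalForm

theorem of_oddAlternating {o : Γ} (ho : OddAlternating C B A o) : HasNormalForm C A B o :=
  Or.inr ⟨o, ho, DoubleCoset.mem_doubleCoset_self A A o⟩

theorem mul_left {a g : Γ} (ha : a ∈ A) (hg : HasNormalForm C A B g) :
    HasNormalForm C A B (a * g) := by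
  refine hg.imp (mul_mem ha) ?_
  rintro ⟨o, ho, hgo⟩
  obtain ⟨a₀, h₀, a₁, h₁, rfl⟩ := DoubleCoset.mem_doubleCoset.1 hgo
  exact ⟨o, ho, DoubleCoset.mem_doubleCoset.2 ⟨a * a₀, mul_mem ha h₀, a₁, h₁, by group⟩⟩

theorem mul_right {a g : Γ} (ha : a ∈ A) (hg : HasNormalForm C A B g) :
    HasNormalForm C A B (g * a) := by
  refine hg.imp (fun h => mul_mem h ha) ?_
  rintro ⟨o, ho, hgo⟩
  obtain ⟨a₀, h₀, a₁, h₁, rfl⟩ := DoubleCoset.mem_doubleCoset.1 hgo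
  exact ⟨o, ho, DoubleCoset.mem_doubleCoset.2 ⟨a₀, h₀, a₁ * a, mul_mem h₁ ha, by group⟩⟩

theorem mul_oddAlternating (hCA : C ≤ A) {b o : Γ} (hb : b ∈ B) (ho : OddAlternating C B A o) :
    HasNormalForm C A B (b * o) := by
  induction ho using OddAlternating.cons_induction with
  | single x hx _ =>
    by_cases hbx : b * x ∈ C
    · exact Or.inl (hCA hbx)
    · exact of_oddAlternating (.single (mul_mem hb hx) hbx)
  | cons x y o hx _ hy hyC ho _ =>
    have hassoc : b * (x * y * o) = b * x * y * o := by group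
    rw [hassoc]
    by_cases hbx : b * x ∈ C
    · exact (of_oddAlternating ho).mul_left (mul_mem (hCA hbx) hy)
    · exact of_oddAlternating (ho.cons (mul_mem hb hx) hbx hy hyC)

theorem mul_left_of_mem_right (hCA : C ≤ A) (hCB : C ≤ B) {b g : Γ} (hb : b ∈ B)
    (hg : HasNormalForm C A B g) : HasNormalForm C A B (b * g) := by
  by_cases hbC : b ∈ C
  · exact hg.mul_left (hCA hbC)
  obtain hgA | ⟨o, ho, hgo⟩ := hg
  · exact (of_oddAlternating (.single hb hbC)).mul_right hgA
  obtain ⟨a₀, h₀, a₁, h₁, rfl⟩ := DoubleCoset.mem_doubleCoset.1 hgo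
  have hassoc : b * (a₀ * o * a₁) = b * a₀ * o * a₁ := by group
  rw [hassoc]
  refine mul_right h₁ ?_
  by_cases h₀C : a₀ ∈ C
  · exact mul_oddAlternating hCA (mul_mem hb (hCB h₀C)) ho
  · exact of_oddAlternating (ho.cons hb hbC h₀ h₀C)

theorem of_mem_sup (hCA : C ≤ A) (hCB : C ≤ B) {g : Γ} (hg : g ∈ A ⊔ B) :
    HasNormalForm C A B g := by
  have mul_mem_union {x g : Γ} (hx : x ∈ A ∨ x ∈ B) (hg : HasNormalForm C A B g) :
      HasNormalForm C A B (x * g) :=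
    hx.elim hg.mul_left fun hx => hg.mul_left_of_mem_right hCA hCB hx
  rw [Subgroup.sup_eq_closure] at hg
  induction hg using Subgroup.closure_induction_left with
  | one => exact Or.inl (one_mem A)
  | mul_left x hx y _ ih => exact mul_mem_union hx ih
  | inv_mul_cancel x hx y _ ih => exact mul_mem_union (hx.imp inv_mem inv_mem) ih

end HasNormalForm

end NormalForm

section Amalgam

open Monoid

variable {Γ : Type*} [Group Γ] {ι : Type*} {H : ι → Subgroup Γ} {A B C : Subgroup Γ}
  {hC : ∀ i, C ≤ H i}

theorem amalgamMap_of (i : ι) (x : H i) : amalgamMap H C hC (PushoutI.of i x) = x :=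
  PushoutI.lift_of _ _ _ _

theorem amalgamMap_base (c : C) : amalgamMap H C hC (PushoutI.base _ c) = c :=
  PushoutI.lift_base _ _ _ _

theorem amalgamMap_ofCoprodI (x : CoprodI fun i => H i) :
    amalgamMap H C hC (PushoutI.ofCoprodI x) = CoprodI.lift (fun i => (H i).subtype) x := by
  refine DFunLike.congr_fun (f := (amalgamMap H C hC).comp PushoutI.ofCoprodI) ?_ x
  ext i y
  simp only [MonoidHom.comp_apply, PushoutI.ofCoprodI_of, amalgamMap_of, CoprodI.lift_of,
    Subgroup.coe_subtype]

theorem lift_neWord_notMem (hinj : Function.Injective (amalgamMap H C hC)) {i j : ι}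
    (w : CoprodI.NeWord (fun i => H i) i j) (hw : ∀ l ∈ w.toList, (l.2 : Γ) ∉ C) :
    CoprodI.lift (fun i => (H i).subtype) w.prod ∉ C := by
  intro hmem
  have hred : PushoutI.Reduced (fun i => Subgroup.inclusion (hC i)) w.toWord := by
    rintro l hl ⟨c, hc⟩
    exact hw l hl (congrArg Subtype.val hc ▸ c.2)
  have hbase : PushoutI.ofCoprodI w.prod ∈
      (PushoutI.base fun i => Subgroup.inclusion (hC i)).range :=
    ⟨⟨_, hmem⟩, hinj (by rw [amalgamMap_base, amalgamMap_ofCoprodI])⟩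
  have hempty := hred.eq_empty_of_mem_range (fun i => Subgroup.inclusion_injective (hC i)) hbase
  exact w.toList_ne_nil (congrArg CoprodI.Word.toList hempty)

theorem OddAlternating.exists_neWord {i j : ι} (hij : i ≠ j) {g : Γ}
    (hg : OddAlternating C (H i) (H j) g) :
    ∃ w : CoprodI.NeWord (fun i => H i) i i,
      (∀ l ∈ w.toList, (l.2 : Γ) ∉ C) ∧ CoprodI.lift (fun i => (H i).subtype) w.prod = g := by
  have ne_one {k : ι} {x : Γ} (hx : x ∈ H k) (hxC : x ∉ C) : (⟨x, hx⟩ : H k) ≠ 1 := fun h =>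
    hxC ((H k).mk_eq_one.1 h ▸ one_mem C)
  induction hg using OddAlternating.cons_induction with
  | single x hx hxC => exact ⟨.singleton ⟨x, hx⟩ (ne_one hx hxC), by simpa using hxC, by simp⟩
  | cons x y g hx hxC hy hyC _ ih =>
    obtain ⟨w, hw, rfl⟩ := ih
    refine ⟨.append (.append (.singleton ⟨x, hx⟩ (ne_one hx hxC)) hij
      (.singleton ⟨y, hy⟩ (ne_one hy hyC))) hij.symm w, ?_, by simp⟩
    simp only [CoprodI.NeWord.toList, List.mem_append, List.mem_singleton]
    rintro l ((rfl | rfl) | hl)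
    exacts [hxC, hyC, hw l hl]

theorem OddAlternating.notMem_of_injective_amalgamMap
    (hinj : Function.Injective (amalgamMap H C hC)) {i j : ι} (hij : i ≠ j) {g : Γ}
    (hg : OddAlternating C (H i) (H j) g) : g ∉ H j := by
  intro hgH
  obtain ⟨w, hw, hwg⟩ := hg.exists_neWord hij
  have hgC : g ∉ C := hwg ▸ lift_neWord_notMem hinj w hw
  have hne : (⟨g, hgH⟩⁻¹ : H j) ≠ 1 :=
    inv_ne_one.2 fun h => hgC ((H j).mk_eq_one.1 h ▸ one_mem C)
  refine lift_neWord_notMem hinj (w.append hij (.singleton _ hne)) ?_ (by simp [hwg])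
  simp only [CoprodI.NeWord.toList, List.mem_append, List.mem_singleton]
  rintro l (hl | rfl)
  exacts [hw l hl, mt inv_mem_iff.1 hgC]

namespace IsAmalgamatedProduct

theorem le_left (h : IsAmalgamatedProduct A B C) : C ≤ A := h.1 0

theorem le_right (h : IsAmalgamatedProduct A B C) : C ≤ B := h.1 1

theorem notMem_left (h : IsAmalgamatedProduct A B C) {g : Γ} (hg : OddAlternating C B A g) :
    g ∉ A :=
  hg.notMem_of_injective_amalgamMap (H := ![A, B]) h.2.1 (i := 1) (j := 0) (by decide)

theorem inf_le (h : IsAmalgamatedProduct A B C) : A ⊓ B ≤ C := fun x hx => by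
  by_contra hxC
  exact h.notMem_left (.single hx.2 hxC) hx.1

theorem sup_eq_top (h : IsAmalgamatedProduct A B C) : A ⊔ B = ⊤ := by
  obtain ⟨hC, -, hsurj⟩ := h
  refine eq_top_iff.2 fun g _ => ?_
  obtain ⟨x, rfl⟩ := hsurj g
  induction x using PushoutI.induction_on with
  | of i x =>
    rw [amalgamMap_of]
    fin_cases i
    exacts [Subgroup.mem_sup_left x.2, Subgroup.mem_sup_right x.2]
  | base c => exact amalgamMap_base (hC := hC) c ▸ Subgroup.mem_sup_left (hC 0 c.2)
  | mul x y hx hy => exact map_mul (amalgamMap _ _ hC) x y ▸ mul_mem (hx trivial) (hy trivial)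

end IsAmalgamatedProduct

theorem amalgamMap_zpowers_injective {x : ι → Γ} (hx : Function.Injective (FreeGroup.lift x)) :
    Function.Injective (amalgamMap (fun i => Subgroup.zpowers (x i)) ⊥ fun _ => bot_le) := by
  let ψ : FreeGroup ι →* PushoutI fun i => Subgroup.inclusion
      (bot_le : ⊥ ≤ Subgroup.zpowers (x i)) :=
    FreeGroup.lift fun i => PushoutI.of i ⟨x i, Subgroup.mem_zpowers (x i)⟩
  have hψ : Function.Surjective ψ := by
    intro y
    induction y using PushoutI.induction_on with
    | of i y =>
      obtain ⟨_, k, rfl⟩ := y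
      refine ⟨FreeGroup.of i ^ k, ?_⟩
      simp only [ψ, map_zpow, FreeGroup.lift_apply_of]
      rw [← map_zpow]
      rfl
    | base c => exact ⟨1, by rw [Subsingleton.elim c 1, map_one, map_one]⟩
    | mul y z hy hz =>
      obtain ⟨⟨v, rfl⟩, w, rfl⟩ := And.intro hy hz
      exact ⟨v * w, map_mul ψ v w⟩
  have hcomp : (amalgamMap (fun i => Subgroup.zpowers (x i)) ⊥ fun _ => bot_le).comp ψ =
      FreeGroup.lift x := by
    ext i
    simp only [ψ, MonoidHom.comp_apply, FreeGroup.lift_apply_of, amalgamMap_of]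
  exact Function.Injective.of_comp_right (by rwa [← MonoidHom.coe_comp, hcomp]) hψ

theorem OddAlternating.notMem_zpowers {b c : Γ} (hbc : Function.Injective (FreeGroup.lift ![b, c]))
    {g : Γ} (hg : OddAlternating ⊥ (Subgroup.zpowers b) (Subgroup.zpowers c) g) :
    g ∉ Subgroup.zpowers c :=
  hg.notMem_of_injective_amalgamMap (H := fun i => Subgroup.zpowers (![b, c] i))
    (amalgamMap_zpowers_injective hbc) (i := 0) (j := 1) (by decide)

end Amalgam

section Acylindrical

variable {Γ : Type*} [Group Γ] {A B C : Subgroup Γ}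

theorem IsAcylindrical.eq_one_of_smul_eq {V : Type*} [MulAction Γ V] {T : SimpleGraph V}
    (hT : IsAcylindrical Γ T 1) {x y z : V} (hxy : T.Adj x y) (hyz : T.Adj y z) (hxz : x ≠ z)
    (hnadj : ¬ T.Adj x z) {g : Γ} (hx : g • x = x) (hy : g • y = y) (hz : g • z = z) : g = 1 := by
  let p : T.Walk x z := .cons hxy (.cons hyz .nil)
  have hp : p.length = 2 := rfl
  have hle : T.dist x z ≤ 2 := SimpleGraph.dist_le p
  have h0 : T.dist x z ≠ 0 := fun h => hxz (p.reachable.dist_eq_zero_iff.1 h)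
  have h1 : T.dist x z ≠ 1 := fun h => hnadj (SimpleGraph.dist_eq_one_iff_adj.1 h)
  refine hT x z p (by lia) (by lia) g ?_
  simp only [p, SimpleGraph.Walk.support_cons, SimpleGraph.Walk.support_nil, List.forall_mem_cons]
  exact ⟨hx, hy, hz, List.forall_mem_nil _⟩

theorem smul_coe_eq_of_conj_mem {x g : Γ} (h : x⁻¹ * g * x ∈ A) :
    g • (x : Γ ⧸ A) = (x : Γ ⧸ A) := by
  rw [MulAction.Quotient.smul_coe, smul_eq_mul, eq_comm, QuotientGroup.eq, ← mul_assoc]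
  exact h

theorem bassSerreTree_adj_inl_inr (g : Γ) :
    (bassSerreTree A B).Adj (Sum.inl (g : Γ ⧸ A)) (Sum.inr (g : Γ ⧸ B)) :=
  ⟨g, Or.inl ⟨rfl, rfl⟩⟩

theorem coe_inv_eq_coe_one_iff {x : Γ} : ((x⁻¹ : Γ) : Γ ⧸ A) = ((1 : Γ) : Γ ⧸ A) ↔ x ∈ A := by
  rw [QuotientGroup.eq, inv_inv, mul_one]

theorem IsAcylindrical.isMalnormalIn_left (hT : IsAcylindrical Γ (bassSerreTree A B) 1)
    (hCA : C ≤ A) (hCB : C ≤ B) (hAB : A ⊓ B ≤ C) : IsMalnormalIn C A where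
  le := hCA
  eq_one_of_conj_mem := by
    intro x c hx hxC hc hxc
    have hpath := (bassSerreTree_adj_inl_inr (A := A) (B := B) x⁻¹).symm
    rw [coe_inv_eq_coe_one_iff.2 hx] at hpath
    refine hT.eq_one_of_smul_eq hpath (bassSerreTree_adj_inl_inr 1) ?_ ?_
      (congrArg Sum.inr (smul_coe_eq_of_conj_mem ?_))
      (congrArg Sum.inl (smul_coe_eq_of_conj_mem ?_))
      (congrArg Sum.inr (smul_coe_eq_of_conj_mem ?_))
    · exact fun h => hxC (hAB ⟨hx, coe_inv_eq_coe_one_iff.1 (Sum.inr_injective h)⟩)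
    · rintro ⟨g, ⟨h, -⟩ | ⟨-, h⟩⟩ <;> cases h
    · simpa using hCB hxc
    · simpa using hCA hc
    · simpa using hCB hc

theorem IsAcylindrical.isMalnormalIn_right (hT : IsAcylindrical Γ (bassSerreTree A B) 1)
    (hCA : C ≤ A) (hCB : C ≤ B) (hAB : A ⊓ B ≤ C) : IsMalnormalIn C B where
  le := hCB
  eq_one_of_conj_mem := by
    intro x c hx hxC hc hxc
    have hpath := bassSerreTree_adj_inl_inr (A := A) (B := B) x⁻¹
    rw [coe_inv_eq_coe_one_iff.2 hx] at hpath
    refine hT.eq_one_of_smul_eq hpath (bassSerreTree_adj_inl_inr 1).symm ?_ ?_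
      (congrArg Sum.inl (smul_coe_eq_of_conj_mem ?_))
      (congrArg Sum.inr (smul_coe_eq_of_conj_mem ?_))
      (congrArg Sum.inl (smul_coe_eq_of_conj_mem ?_))
    · exact fun h => hxC (hAB ⟨coe_inv_eq_coe_one_iff.1 (Sum.inl_injective h), hx⟩)
    · rintro ⟨g, ⟨-, h⟩ | ⟨h, -⟩⟩ <;> cases h
    · simpa using hCA hxc
    · simpa using hCB hc
    · simpa using hCA hc

end Acylindrical

section FreeProduct

open Monoid

variable {Γ : Type*} [Group Γ] {A : Subgroup Γ} {γ : Γ}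

theorem coprodLift_injective_of_notMem_range {G K : Type*} [Group G] [Group K] {f : G →* Γ}
    {g : K →* Γ} (hf : Function.Injective f) (hg : Function.Injective g)
    (h : ∀ x, OddAlternating ⊥ g.range f.range x → x ∉ f.range) :
    Function.Injective (Coprod.lift f g) := by
  refine (injective_iff_map_eq_one _).2 fun x hx => ?_
  have hnf : HasNormalForm ⊥ Coprod.inl.range Coprod.inr.range x :=
    .of_mem_sup bot_le bot_le (Coprod.range_inl_sup_range_inr (G := G) (H := K) ▸ trivial)
  obtain ⟨a, rfl⟩ | ⟨o, ho, hxo⟩ := hnf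
  · rw [Coprod.lift_apply_inl] at hx
    rw [(injective_iff_map_eq_one f).1 hf a hx, map_one]
  obtain ⟨_, ⟨a, rfl⟩, _, ⟨b, rfl⟩, rfl⟩ := DoubleCoset.mem_doubleCoset.1 hxo
  have himage : OddAlternating ⊥ g.range f.range (Coprod.lift f g o) := by
    refine ho.map _ ?_ ?_
    · rintro _ ⟨k, rfl⟩ hk
      rw [Coprod.lift_apply_inr]
      exact ⟨⟨k, rfl⟩, fun h => hk (by rw [(injective_iff_map_eq_one g).1 hg k h, map_one]; rfl)⟩
    · rintro _ ⟨a, rfl⟩ ha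
      rw [Coprod.lift_apply_inl]
      exact ⟨⟨a, rfl⟩, fun h => ha (by rw [(injective_iff_map_eq_one f).1 hf a h, map_one]; rfl)⟩
  refine absurd ⟨a⁻¹ * b⁻¹, ?_⟩ (h _ himage)
  rw [map_mul, map_mul, Coprod.lift_apply_inl, Coprod.lift_apply_inl] at hx
  rw [map_mul, map_inv, map_inv, inv_mul_eq_iff_eq_mul]
  exact inv_eq_of_mul_eq_one_left hx

/-- `A` and `γ` generate the free product of `A` and an infinite cyclic group generated by `γ`.
The second factor is `ℤ`, not `⟨γ⟩`, so that `γ` can be replaced by other elements. -/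
def IsFreeOver (A : Subgroup Γ) (γ : Γ) : Prop :=
  Function.Injective (Coprod.lift A.subtype (zpowersHom Γ γ))

namespace IsFreeOver

theorem of_notMem [IsMulTorsionFree Γ] (hγ : γ ≠ 1)
    (h : ∀ x, OddAlternating ⊥ (Subgroup.zpowers γ) A x → x ∉ A) : IsFreeOver A γ := by
  refine coprodLift_injective_of_notMem_range A.subtype_injective ?_ ?_
  · refine (injective_iff_map_eq_one _).2 fun n hn => ?_
    exact (IsMulTorsionFree.zpow_eq_one_iff_right hγ).1 hn
  · rwa [A.range_subtype, Subgroup.range_zpowersHom]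

theorem mul_mul {a b : Γ} (h : IsFreeOver A γ) (ha : a ∈ A) (hb : b ∈ A) :
    IsFreeOver A (a * γ * b) := by
  let τ (a b : A) : Coprod A (Multiplicative ℤ) →* Coprod A (Multiplicative ℤ) :=
    Coprod.lift Coprod.inl
      (zpowersHom _ (Coprod.inl a * Coprod.inr (Multiplicative.ofAdd 1) * Coprod.inl b))
  have hτ (a b : A) : (τ a⁻¹ b⁻¹).comp (τ a b) = MonoidHom.id _ := by
    ext
    · simp [τ]
    · simp [τ, mul_assoc]
  have hcomp : Coprod.lift A.subtype (zpowersHom Γ (a * γ * b)) =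
      (Coprod.lift A.subtype (zpowersHom Γ γ)).comp (τ ⟨a, ha⟩ ⟨b, hb⟩) := by
    ext <;> simp [τ]
  have hinj : Function.LeftInverse (τ ⟨a, ha⟩⁻¹ ⟨b, hb⟩⁻¹) (τ ⟨a, ha⟩ ⟨b, hb⟩) :=
    DFunLike.congr_fun (hτ _ _)
  rw [IsFreeOver, hcomp]
  exact h.comp hinj.injective

theorem isInternalFreeProduct (h : IsFreeOver A γ) :
    IsInternalFreeProduct A (Subgroup.zpowers γ) (Subgroup.closure ((A : Set Γ) ∪ {γ})) := by
  constructor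
  · let r : Multiplicative ℤ →* Subgroup.zpowers γ := zpowersHom _ ⟨γ, Subgroup.mem_zpowers γ⟩
    have hr : Function.Surjective r := by
      rintro ⟨_, k, rfl⟩
      exact ⟨Multiplicative.ofAdd k, rfl⟩
    have hmap : Function.Surjective (Coprod.map (MonoidHom.id A) r) := by
      rw [← MonoidHom.range_eq_top, Coprod.range_eq, Coprod.map_comp_inl, Coprod.map_comp_inr,
        MonoidHom.comp_id, MonoidHom.range_comp, MonoidHom.range_eq_top.2 hr,
        ← MonoidHom.range_eq_map, Coprod.range_inl_sup_range_inr]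
    have hcomp : (Coprod.lift A.subtype (Subgroup.zpowers γ).subtype).comp
        (Coprod.map (MonoidHom.id A) r) = Coprod.lift A.subtype (zpowersHom Γ γ) := by
      ext <;> simp [r]
    exact Function.Injective.of_comp_right (by rwa [← MonoidHom.coe_comp, hcomp]) hmap
  · rw [Coprod.range_lift, Subgroup.range_subtype, Subgroup.range_subtype,
      Subgroup.closure_union, Subgroup.closure_eq, Subgroup.zpowers_eq_closure]

end IsFreeOver

end FreeProduct

section Freeness

variable {Γ : Type*} [Group Γ] {A B C K : Subgroup Γ} {γ : Γ}

/-- Letters in `A \ C` cause no cancellation: they cut a word in `K` and `A` into words in `K`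
and `C`, each of which starts and ends in `B \ C` once rewritten. -/
theorem OddAlternating.of_bot (h : ∀ x, OddAlternating ⊥ K C x → OddAlternating C B A x) {x : Γ}
    (hx : OddAlternating ⊥ K A x) : OddAlternating C B A x := by
  -- `y` collects the letters that follow the last letter outside `C`.
  suffices ∀ y, (∀ d, OddAlternating ⊥ K C d → OddAlternating ⊥ K C (y * d)) →
      OddAlternating C B A (y * x) from
    one_mul x ▸ this 1 fun d hd => (one_mul d).symm ▸ hd
  induction hx using OddAlternating.cons_induction with
  | single k hk hk1 => exact fun y hy => h _ (hy k (.single hk hk1))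
  | cons k a x hk hk1 ha ha1 _ ih =>
    intro y hy
    have hyk := hy k (.single hk hk1)
    have hassoc : y * (k * a * x) = y * k * a * x := by group
    rw [hassoc]
    by_cases haC : a ∈ C
    · exact ih _ fun d hd => hyk.append haC ha1 hd
    · exact (h _ hyk).append ha haC (one_mul x ▸ ih 1 fun d hd => (one_mul d).symm ▸ hd)

theorem IsFreeOver.of_oddAlternating [IsMulTorsionFree Γ] (hABC : IsAmalgamatedProduct A B C)
    (hγ : γ ∉ A)
    (h : ∀ x, OddAlternating ⊥ (Subgroup.zpowers γ) C x → OddAlternating C B A x) :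
    IsFreeOver A γ :=
  .of_notMem (fun h1 => hγ (h1 ▸ one_mem A)) fun _ hx => hABC.notMem_left (hx.of_bot h)

theorem OddAlternating.notMem_of_isCyclic
    (hfree : ∀ x y : Γ, ¬ Commute x y → Function.Injective (FreeGroup.lift ![x, y]))
    (hC : IsCyclic C) (hB : IsMalnormalIn C B) {b x : Γ} (hb : b ∈ B) (hbC : b ∉ C)
    (hx : OddAlternating ⊥ (Subgroup.zpowers b) C x) : x ∉ C := by
  obtain ⟨c, rfl⟩ := (Subgroup.isCyclic_iff_exists_zpowers_eq_top C).1 hC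
  by_cases hc : c = 1
  · rw [hc, Subgroup.zpowers_one_eq_bot] at hx ⊢
    cases hx using OddAlternating.cons_induction with
    | single _ _ hx1 => exact hx1
    | cons _ y _ _ _ hy hy1 => exact absurd hy hy1
  · refine hx.notMem_zpowers (hfree b c fun hcomm => hc ?_)
    have hcC := Subgroup.mem_zpowers c
    exact hB.eq_one_of_conj_mem hb hbC hcC (by rwa [hcomm.eq, mul_inv_cancel_right])

theorem IsFreeOver.of_mem [IsMulTorsionFree Γ]
    (hfree : ∀ x y : Γ, ¬ Commute x y → Function.Injective (FreeGroup.lift ![x, y]))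
    (hABC : IsAmalgamatedProduct A B C) (hC : IsCyclic C) (hB : IsMalnormalIn C B) {b : Γ}
    (hb : b ∈ B) (hbC : b ∉ C) : IsFreeOver A b :=
  .of_oddAlternating hABC (hABC.notMem_left (.single hb hbC)) fun _ hx =>
    .single (hx.mem_of_le (Subgroup.zpowers_le.2 hb) hB.le)
      (hx.notMem_of_isCyclic hfree hC hB hb hbC)

/-- Products `l * m * l'⁻¹` with `l, l' ∈ L`, where `m` is an alternating product that starts and
ends in `A \ C`. With the second outer letter inverted, the notion is invariant under inversion. -/
def IsFramed (C A B : Subgroup Γ) (L : Set Γ) (x : Γ) : Prop :=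
  ∃ l ∈ L, ∃ l' ∈ L, ∃ m, OddAlternating C A B m ∧ x = l * m * l'⁻¹

namespace IsFramed

variable {L : Set Γ}

theorem inv {x : Γ} (hx : IsFramed C A B L x) : IsFramed C A B L x⁻¹ := by
  obtain ⟨l, hl, l', hl', m, hm, rfl⟩ := hx
  exact ⟨l', hl', l, hl, m⁻¹, hm.inv, by group⟩

theorem oddAlternating (hL : L ⊆ (B : Set Γ) \ C) {x : Γ} (hx : IsFramed C A B L x) :
    OddAlternating C B A x := by
  obtain ⟨l, hl, l', hl', m, hm, rfl⟩ := hx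
  exact .wrap (hL hl).1 (hL hl).2 hm (inv_mem (hL hl').1) (mt inv_mem_iff.1 (hL hl').2)

theorem of_mem_zpowers (hpow : ∀ n : ℕ, n ≠ 0 → IsFramed C A B L (γ ^ n)) {x : Γ}
    (hx : x ∈ Subgroup.zpowers γ) (hx1 : x ≠ 1) : IsFramed C A B L x := by
  obtain ⟨k, rfl⟩ := hx
  obtain ⟨n, hkn⟩ := k.eq_nat_or_neg
  have hn : n ≠ 0 := by
    rintro rfl
    exact hx1 (by simp_all)
  obtain rfl | rfl := hkn
  · simpa using hpow n hn
  · simpa using (hpow n hn).inv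

theorem of_oddAlternating (hCB : C ≤ B) (hL : L ⊆ (B : Set Γ) \ C)
    (hLC : ∀ l ∈ L, ∀ l' ∈ L, ∀ c ∈ C, c ≠ 1 → l⁻¹ * c * l' ∉ C)
    (hK : ∀ x ∈ K, x ≠ 1 → IsFramed C A B L x) {x : Γ} (hx : OddAlternating ⊥ K C x) :
    IsFramed C A B L x := by
  induction hx using OddAlternating.cons_induction with
  | single x hx hx1 => exact hK x hx hx1
  | cons x c y hx hx1 hc hc1 _ ih =>
    obtain ⟨l₁, hl₁, l₁', hl₁', m₁, hm₁, rfl⟩ := hK x hx hx1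
    obtain ⟨l₂, hl₂, l₂', hl₂', m₂, hm₂, rfl⟩ := ih
    have hmid : l₁'⁻¹ * c * l₂ ∈ B := mul_mem (mul_mem (inv_mem (hL hl₁').1) (hCB hc)) (hL hl₂).1
    exact ⟨l₁, hl₁, l₂', hl₂', m₁ * (l₁'⁻¹ * c * l₂) * m₂,
      hm₁.append hmid (hLC _ hl₁' _ hl₂ _ hc hc1) hm₂, by group⟩

theorem isFreeOver [IsMulTorsionFree Γ] (hABC : IsAmalgamatedProduct A B C)
    (hL : L ⊆ (B : Set Γ) \ C)
    (hLC : ∀ l ∈ L, ∀ l' ∈ L, ∀ c ∈ C, c ≠ 1 → l⁻¹ * c * l' ∉ C)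
    (hpow : ∀ n : ℕ, n ≠ 0 → IsFramed C A B L (γ ^ n)) : IsFreeOver A γ := by
  have hγ : OddAlternating C B A γ := pow_one γ ▸ (hpow 1 one_ne_zero).oddAlternating hL
  have hzpow : ∀ x ∈ Subgroup.zpowers γ, x ≠ 1 → IsFramed C A B L x :=
    fun _ => of_mem_zpowers hpow
  exact .of_oddAlternating hABC (hABC.notMem_left hγ) fun _ hx =>
    (of_oddAlternating hABC.le_right hL hLC hzpow hx).oddAlternating hL

end IsFramed

theorem IsFreeOver.of_mul_mul [IsMulTorsionFree Γ] (hABC : IsAmalgamatedProduct A B C)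
    (hB : IsMalnormalIn C B) {p m q : Γ} (hp : p ∈ B) (hpC : p ∉ C)
    (hm : OddAlternating C A B m) (hq : q ∈ B) (hqC : q ∉ C) (hqp : ∀ c ∈ C, q * c * p ∉ C) :
    IsFreeOver A (p * m * q) := by
  have hq' : q⁻¹ ∈ B ∧ q⁻¹ ∉ C := ⟨inv_mem hq, mt inv_mem_iff.1 hqC⟩
  refine IsFramed.isFreeOver (L := {p, q⁻¹}) hABC ?_ ?_ fun n hn => ?_
  · rintro _ (rfl | rfl)
    exacts [⟨hp, hpC⟩, hq']
  · rintro l (hl | hl) l' (hl' | hl') c hc hc1 <;> rw [hl, hl']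
    · exact hB.inv_mul_mul_notMem hp hpC hc hc1
    · refine fun h => hqp c⁻¹ (inv_mem hc) (inv_mem_iff.1 ?_)
      simpa only [mul_inv_rev, inv_inv, mul_assoc] using h
    · exact (inv_inv q).symm ▸ hqp c hc
    · exact hB.inv_mul_mul_notMem hq'.1 hq'.2 hc hc1
  · have hqp1 : q * p ∉ C := mul_one q ▸ hqp 1 (one_mem C)
    obtain ⟨z, hz, hpow⟩ := OddAlternating.exists_pow_eq hp hq hqp1 hm hn
    exact ⟨p, Or.inl rfl, q⁻¹, Or.inr rfl, z, hz, (inv_inv q).symm ▸ hpow⟩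

theorem IsFreeOver.of_conj [IsMulTorsionFree Γ] (hABC : IsAmalgamatedProduct A B C)
    (hA : IsMalnormalIn C A) (hB : IsMalnormalIn C B) {p m : Γ} (hp : p ∈ B) (hpC : p ∉ C)
    (hm : OddAlternating C A B m) : IsFreeOver A (p * m * p⁻¹) := by
  refine IsFramed.isFreeOver (L := {p}) hABC (Set.singleton_subset_iff.2 ⟨hp, hpC⟩) ?_ ?_
  · rintro _ rfl _ rfl c hc hc1
    exact hB.inv_mul_mul_notMem hp hpC hc hc1
  · exact fun n hn => ⟨p, rfl, p, rfl, m ^ n, hm.pow hA hB hn, conj_pow⟩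

theorem OddAlternating.isFreeOver [IsMulTorsionFree Γ]
    (hfree : ∀ x y : Γ, ¬ Commute x y → Function.Injective (FreeGroup.lift ![x, y]))
    (hABC : IsAmalgamatedProduct A B C) (hC : IsCyclic C) (hA : IsMalnormalIn C A)
    (hB : IsMalnormalIn C B) (hγ : OddAlternating C B A γ) : IsFreeOver A γ := by
  cases hγ with
  | single hb hbC => exact .of_mem hfree hABC hC hB hb hbC
  | @wrap _ _ p m q hp hpC hm hq hqC =>
    by_cases hqp : ∀ c ∈ C, q * c * p ∉ C
    · exact .of_mul_mul hABC hB hp hpC hm hq hqC hqp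
    push Not at hqp
    obtain ⟨c, hc, hd⟩ := hqp
    have hconj : p * m * q = 1 * (p * (m * (q * c * p)) * p⁻¹) * c⁻¹ := by group
    rw [hconj]
    exact (IsFreeOver.of_conj hABC hA hB hp hpC (hm.mul_right hA.le hd)).mul_mul
      (one_mem A) (hA.le (inv_mem hc))

end Freeness

theorem theorem4p1_general {Γ : Type*} [Group Γ] [IsMulTorsionFree Γ]
    (hfree : ∀ x y : Γ, ¬ Commute x y → Function.Injective (FreeGroup.lift ![x, y]))
    {A B C : Subgroup Γ} (hABC : IsAmalgamatedProduct A B C) (hC : IsCyclic C)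
    (hacyl : IsAcylindrical Γ (bassSerreTree A B) 1) {γ : Γ} (hγ : γ ∉ A) :
    IsInternalFreeProduct A (Subgroup.zpowers γ) (Subgroup.closure ((A : Set Γ) ∪ {γ})) := by
  have hA := hacyl.isMalnormalIn_left hABC.le_left hABC.le_right hABC.inf_le
  have hB := hacyl.isMalnormalIn_right hABC.le_left hABC.le_right hABC.inf_le
  have hnf : HasNormalForm C A B γ := .of_mem_sup hA.le hB.le (hABC.sup_eq_top ▸ trivial)
  obtain ⟨o, ho, hγo⟩ := hnf.resolve_left hγ
  obtain ⟨a₀, h₀, a₁, h₁, rfl⟩ := DoubleCoset.mem_doubleCoset.1 hγo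
  exact ((ho.isFreeOver hfree hABC hC hA hB).mul_mul h₀ h₁).isInternalFreeProduct

theorem theorem4p1 {Γ : Type u} [Group Γ] (hΓ : IsLimitGroup Γ)
    (A B C : Subgroup Γ) (hABC : IsAmalgamatedProduct A B C) (hC : IsCyclic C)
    (hacyl : IsAcylindrical Γ (bassSerreTree A B) 1)
    (γ : Γ) (hγ : γ ∉ A) :
    IsInternalFreeProduct A (Subgroup.zpowers γ) (Subgroup.closure ((A : Set Γ) ∪ {γ})) :=
  have := hΓ.isMulTorsionFree
  theorem4p1_general (fun _ _ => hΓ.freeGroupLift_injective) hABC hC hacyl hγ
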